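/- For $n\ge 1$ let $T_n$ be a uniformly random tournament on $n$ vertices, i.e. an orientation of the complete graph $K_n$ chosen with all $2^{\binom n2}$ orientations equally likely. For a vertex $v$ let $N_i(v)$ be the set of vertices at directed distance exactly $i$ from $v$; call $v$ a Seymour vertex if $|N_2(v)|\ge |N_1(v)|$, and let $S$ be the set of Seymour vertices of $T_n$. Then there are constants $C_1,C_2$ such that $$\mathrm{Var}(|S|)\sim C_1 n\quad\text{as } n\to\infty \text{ through even integers},\qquad \mathrm{Var}(|S|)\sim C_2 n\quad\text{as } n\to\infty\text{ through odd integers},$$ and their values are $$C_1=C_2=\frac14-\frac1{2\pi}.$$ -/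

import Mathlib

open scoped Topology Asymptotics
open MeasureTheory ProbabilityTheory Filter

namespace Seymour

variable {V : Type*}

/-- `HasWalk D k u w`: the digraph `D` has a directed walk with exactly `k` arcs from `u` to `w`. -/
def HasWalk (D : Digraph V) : ℕ → V → V → Prop
  | 0, u, w => u = w
  | k + 1, u, w => ∃ x, D.Adj u x ∧ HasWalk D k x w

/-- `N_i(u)`: the vertices `w` for which the shortest directed path from `u` to `w` has length `i`
(a shortest directed walk is a shortest directed path). -/
def nbhd (D : Digraph V) (i : ℕ) (u : V) : Set V :=
  {w | HasWalk D i u w ∧ ∀ j < i, ¬ HasWalk D j u w}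

/-- `v` is a Seymour vertex: `|N_2(v)| ≥ |N_1(v)|`. -/
def IsSeymourVertex (D : Digraph V) (v : V) : Prop :=
  (nbhd D 1 v).ncard ≤ (nbhd D 2 v).ncard

/-- The set `S` of all Seymour vertices of `D`. -/
def seymourSet (D : Digraph V) : Set V :=
  {v | IsSeymourVertex D v}

/-- `D` is an orientation of the graph `G`: for every edge `uv` of `G` exactly one of the arcs
`u → v`, `v → u` is present, and `D` has no other arcs. -/
def IsOrientation (G : SimpleGraph V) (D : Digraph V) : Prop :=
  (∀ u v, G.Adj u v ↔ D.Adj u v ∨ D.Adj v u) ∧ ∀ u v, ¬ (D.Adj u v ∧ D.Adj v u)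

/-- Tournaments on the vertex set `V`: the orientations of the complete graph on `V`. -/
def Tournament (V : Type*) : Type _ :=
  {D : Digraph V // IsOrientation (⊤ : SimpleGraph V) D}

instance [Finite V] : Finite (Tournament V) := by
  classical
  have := Fintype.ofFinite V
  have : Finite (Digraph V) := inferInstance
  exact inferInstanceAs (Finite {D : Digraph V // IsOrientation (⊤ : SimpleGraph V) D})

instance (n : ℕ) : Nonempty (Tournament (Fin n)) :=
  ⟨⟨⟨fun i j => i < j⟩, fun u v => by rw [SimpleGraph.top_adj]; exact ne_iff_lt_or_gt,
    fun u v h => lt_asymm h.1 h.2⟩⟩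

/-- Every set of tournaments is an event. -/
instance : MeasurableSpace (Tournament V) := ⊤

/-- The law of the random tournament `T_n`: all orientations of the complete graph on `n` vertices
are equally likely. -/
noncomputable def randomTournament (n : ℕ) : Measure (Tournament (Fin n)) :=
  uniformOn Set.univ

instance (n : ℕ) : IsProbabilityMeasure (randomTournament n) :=
  inferInstanceAs (IsProbabilityMeasure (uniformOn (Set.univ : Set (Tournament (Fin n)))))

/-- The variance of `|S|` for the random tournament `T_n`. -/
noncomputable def varSeymour (n : ℕ) : ℝ :=
  variance (fun T : Tournament (Fin n) => ((seymourSet T.1).ncard : ℝ)) (randomTournament n)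

end Seymour

/-! ### Tournaments and arc reversal -/

namespace Seymour

open scoped BigOperators

variable {V : Type*}

/-! Let n = N + 2. A fixed ordered pair of vertices is joined by no path of length two with
probability (3/4)^N, so outside an exponentially unlikely event every pair is so joined. A vertex of
out-degree d then has n - 1 - d second neighbours and is Seymour exactly when 2d + 1 ≤ n. Since |S|
≤ n, replacing |S| by the number `halfCount` of such vertices changes the variance by o(1)
(`abs_variance_sub_le`).

Given the direction of the arc between a and b, their numbers of other out-neighbours are
independent Bin(N, 1/2) variables (`expect_profile`). Let L and U be the probabilities that a vertex
meets the degree bound when this arc leaves or enters it. Each indicator has mean p = (L + U)/2, and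
a product of two has mean LU, so the covariance is -(U - L)²/4, where U - L is a central binomial
probability c. The variance of `halfCount` is therefore n p(1 - p) - n(n - 1)c²/4. Here p → 1/2, and
Wallis' product gives N c² → 2/π: the covariances contribute at order n, and the constant is 1/4 -
1/(2π). Parity affects neither limit, so the asymptotics hold along all n. -/

theorem Tournament.adj_comm_iff (T : Tournament V) {u v : V} (h : u ≠ v) :
    T.1.Adj v u ↔ ¬ T.1.Adj u v := by
  have h1 := T.2.1 u v
  have h2 := T.2.2 u v
  rw [SimpleGraph.top_adj] at h1
  tauto

theorem Tournament.not_adj_self (T : Tournament V) (u : V) : ¬ T.1.Adj u u :=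
  fun h => T.2.2 u u ⟨h, h⟩

noncomputable instance [Finite V] : Fintype (Tournament V) := Fintype.ofFinite _

/-- Reverse the arcs of `T` along the symmetric relation `F`. -/
def Tournament.flip (F : V → V → Prop) (hF : ∀ u v, F u v → F v u) (T : Tournament V) :
    Tournament V :=
  ⟨⟨fun u v => (F u v ∧ T.1.Adj v u) ∨ (¬ F u v ∧ T.1.Adj u v)⟩, by
    constructor
    · intro u v
      have h1 := T.2.1 u v
      have h2 := hF u v
      have h3 := hF v u
      simp only
      tauto
    · intro u v
      have h1 := T.2.2 u v
      have h2 := hF u v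
      have h3 := hF v u
      simp only
      tauto⟩

theorem Tournament.flip_flip (F : V → V → Prop) (hF : ∀ u v, F u v → F v u) (T : Tournament V) :
    (T.flip F hF).flip F hF = T := by
  apply Subtype.ext
  have : ∀ u v, ((T.flip F hF).flip F hF).1.Adj u v ↔ T.1.Adj u v := by
    intro u v
    have h2 := hF u v
    have h3 := hF v u
    simp only [Tournament.flip]
    tauto
  ext u v
  exact this u v

/-- The vertices other than `a` and `b`. -/
abbrev Rest (a b : V) : Type _ := {x : V // x ≠ a ∧ x ≠ b}

/-! ### Independence of the arcs at two vertices -/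

section Profile

open Classical in
/-- Whether `a → b`, together with the out-neighbours of `a` and of `b` among the other vertices. -/
noncomputable def Tournament.profile [Fintype V] (a b : V) (T : Tournament V) :
    Bool × Finset (Rest a b) × Finset (Rest a b) :=
  (decide (T.1.Adj a b), Finset.univ.filter fun x => T.1.Adj a x,
    Finset.univ.filter fun x => T.1.Adj b x)

/-- The arcs out of `a` and `b` that a profile `c` selects. -/
def selectedArc (a b : V) (c : Bool × Finset (Rest a b) × Finset (Rest a b)) (u v : V) : Prop :=
  (u = a ∧ v = b ∧ c.1 = true) ∨ (u = a ∧ ∃ x ∈ c.2.1, v = x.1) ∨ (u = b ∧ ∃ x ∈ c.2.2, v = x.1)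

/-- Reverse the arcs selected by the profile `c`. -/
def Tournament.flipProfile (a b : V) (c : Bool × Finset (Rest a b) × Finset (Rest a b)) :
    Tournament V → Tournament V :=
  Tournament.flip (fun u v => selectedArc a b c u v ∨ selectedArc a b c v u) fun _ _ h => h.symm

theorem Tournament.flipProfile_involutive (a b : V)
    (c : Bool × Finset (Rest a b) × Finset (Rest a b)) :
    Function.Involutive (Tournament.flipProfile a b c) :=
  fun T => T.flip_flip _ _

theorem selectedArc_iff {a b : V} (hab : a ≠ b)
    (c : Bool × Finset (Rest a b) × Finset (Rest a b)) :
    (selectedArc a b c a b ∨ selectedArc a b c b a) ↔ c.1 = true := by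
  constructor
  · rintro ((⟨-, -, h⟩ | ⟨-, x, -, h⟩ | ⟨h, -⟩) | (⟨h, -⟩ | ⟨h, -⟩ | ⟨-, x, -, h⟩))
    · exact h
    · exact absurd h.symm x.2.2
    · exact absurd h hab
    · exact absurd h.symm hab
    · exact absurd h.symm hab
    · exact absurd h.symm x.2.1
  · exact fun h => Or.inl (Or.inl ⟨rfl, rfl, h⟩)

theorem selectedArc_left_iff {a b : V} (hab : a ≠ b)
    (c : Bool × Finset (Rest a b) × Finset (Rest a b)) (x : Rest a b) :
    (selectedArc a b c a x ∨ selectedArc a b c x a) ↔ x ∈ c.2.1 := by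
  constructor
  · rintro ((⟨-, h, -⟩ | ⟨-, y, hy, h⟩ | ⟨h, -⟩) | (⟨h, -⟩ | ⟨h, -⟩ | ⟨h, -⟩))
    · exact absurd h x.2.2
    · rwa [Subtype.ext h]
    · exact absurd h hab
    · exact absurd h x.2.1
    · exact absurd h x.2.1
    · exact absurd h x.2.2
  · exact fun h => Or.inl (Or.inr (Or.inl ⟨rfl, x, h, rfl⟩))

theorem selectedArc_right_iff {a b : V} (hab : a ≠ b)
    (c : Bool × Finset (Rest a b) × Finset (Rest a b)) (x : Rest a b) :
    (selectedArc a b c b x ∨ selectedArc a b c x b) ↔ x ∈ c.2.2 := by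
  constructor
  · rintro ((⟨h, -⟩ | ⟨h, -⟩ | ⟨-, y, hy, h⟩) | (⟨h, -⟩ | ⟨h, -⟩ | ⟨h, -⟩))
    · exact absurd h.symm hab
    · exact absurd h.symm hab
    · rwa [Subtype.ext h]
    · exact absurd h x.2.1
    · exact absurd h x.2.1
    · exact absurd h x.2.2
  · exact fun h => Or.inl (Or.inr (Or.inr ⟨rfl, x, h, rfl⟩))

open Classical in
/-- The translate of the profile `d` by the profile `c`. -/
noncomputable def translateProfile {α : Type*} (d c : Bool × Finset α × Finset α) :
    Bool × Finset α × Finset α :=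
  (xor d.1 c.1, symmDiff d.2.1 c.2.1, symmDiff d.2.2 c.2.2)

theorem translateProfile_involutive {α : Type*} (d : Bool × Finset α × Finset α) :
    Function.Involutive (translateProfile d) := by
  classical
  intro c
  simp [translateProfile]

theorem Tournament.flip_adj_iff (F : V → V → Prop) (hF : ∀ u v, F u v → F v u) (T : Tournament V)
    {u v : V} (h : u ≠ v) : (T.flip F hF).1.Adj u v ↔ (T.1.Adj u v ↔ ¬ F u v) := by
  have := T.adj_comm_iff h
  simp only [flip]
  tauto

theorem Tournament.profile_flipProfile [Fintype V] {a b : V} (hab : a ≠ b)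
    (c : Bool × Finset (Rest a b) × Finset (Rest a b)) (T : Tournament V) :
    (T.flipProfile a b c).profile a b = translateProfile (T.profile a b) c := by
  classical
  refine Prod.ext ?_ (Prod.ext ?_ ?_)
  · have h : (T.flipProfile a b c).1.Adj a b ↔ (T.1.Adj a b ↔ ¬ c.1 = true) := by
      rw [flipProfile, flip_adj_iff _ _ _ hab, selectedArc_iff hab]
    simp only [profile, translateProfile, h]
    by_cases h : T.1.Adj a b <;> cases c.1 <;> simp [h]
  · ext x
    have h : (T.flipProfile a b c).1.Adj a x ↔ (T.1.Adj a x ↔ x ∉ c.2.1) := by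
      rw [flipProfile, flip_adj_iff _ _ _ x.2.1.symm, selectedArc_left_iff hab]
    simp only [profile, translateProfile, h, Finset.mem_filter, Finset.mem_univ, true_and,
      Finset.mem_symmDiff]
    tauto
  · ext x
    have h : (T.flipProfile a b c).1.Adj b x ↔ (T.1.Adj b x ↔ x ∉ c.2.2) := by
      rw [flipProfile, flip_adj_iff _ _ _ x.2.2.symm, selectedArc_right_iff hab]
    simp only [profile, translateProfile, h, Finset.mem_filter, Finset.mem_univ, true_and,
      Finset.mem_symmDiff]
    tauto

open Classical in
/-- The profile of a uniformly random tournament is uniformly distributed. -/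
theorem expect_profile [Fintype V] [Nonempty (Tournament V)] {a b : V} (hab : a ≠ b)
    (h : Bool × Finset (Rest a b) × Finset (Rest a b) → ℝ) :
    𝔼 T : Tournament V, h (T.profile a b) = 𝔼 c, h c := by
  calc 𝔼 T : Tournament V, h (T.profile a b)
      = 𝔼 c : Bool × Finset (Rest a b) × Finset (Rest a b), 𝔼 T : Tournament V,
          h ((T.flipProfile a b c).profile a b) := by
        rw [← Fintype.expect_const (ι := Bool × Finset (Rest a b) × Finset (Rest a b))
          (𝔼 T : Tournament V, h (T.profile a b))]
        -- For each fixed `c` the reversal permutes the tournaments, so it preserves the mean.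
        refine Finset.expect_congr rfl fun c _ => ?_
        exact (Fintype.expect_bijective _
          (Tournament.flipProfile_involutive a b c).bijective _ _ fun T => rfl).symm
    _ = 𝔼 T : Tournament V, 𝔼 c : Bool × Finset (Rest a b) × Finset (Rest a b),
          h (translateProfile (T.profile a b) c) := by
        rw [Finset.expect_comm]
        simp_rw [Tournament.profile_flipProfile hab]
    _ = 𝔼 T : Tournament V, 𝔼 c, h c := by
        -- For each fixed `T` the translates run once through all profiles, so the inner mean does
        -- not depend on `T`.
        refine Finset.expect_congr rfl fun T _ => ?_
        exact Fintype.expect_bijective _ (translateProfile_involutive _).bijective _ _ fun c => rfl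
    _ = 𝔼 c, h c := Fintype.expect_const _

/-- Conditioning on a fair coin leaves two independent uniform subsets, so each branch factors. -/
theorem expect_bool_prod {α : Type*} [Fintype α] (f₁ f₂ g₁ g₂ : Finset α → ℝ) :
    𝔼 c : Bool × Finset α × Finset α, (if c.1 then f₁ c.2.1 * g₁ c.2.2 else f₂ c.2.1 * g₂ c.2.2)
      = ((𝔼 s, f₁ s) * (𝔼 t, g₁ t) + (𝔼 s, f₂ s) * (𝔼 t, g₂ t)) / 2 := by
  rw [← Finset.univ_product_univ, Finset.expect_product]
  rw [Fintype.expect_eq_sum_div_card (ι := Bool)]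
  simp only [← Finset.univ_product_univ, Finset.expect_product, Fintype.sum_bool, Fintype.card_bool,
    Fintype.expect_mul_expect, if_true, Bool.false_eq_true, if_false, Nat.cast_ofNat]

end Profile

/-! ### Binomial tails and the central term -/

section Binomial

/-- The mean of `g` under the binomial distribution with parameters `N` and `1/2`. -/
noncomputable def binomMean (N : ℕ) (g : ℕ → ℝ) : ℝ :=
  (∑ j ∈ Finset.range (N + 1), (N.choose j : ℝ) * g j) / 2 ^ N

theorem expect_card {α : Type*} [Fintype α] (g : ℕ → ℝ) :
    𝔼 s : Finset α, g s.card = binomMean (Fintype.card α) g := by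
  rw [Fintype.expect_eq_sum_div_card, ← Finset.powerset_univ, Finset.sum_powerset_apply_card]
  simp [binomMean]

theorem binomMean_mono {N : ℕ} {f g : ℕ → ℝ} (h : ∀ j ≤ N, f j ≤ g j) :
    binomMean N f ≤ binomMean N g := by
  unfold binomMean
  gcongr with j hj
  exact h j (by simpa [Nat.lt_succ_iff] using hj)

theorem binomMean_add (N : ℕ) (f g : ℕ → ℝ) :
    binomMean N (fun j => f j + g j) = binomMean N f + binomMean N g := by
  simp only [binomMean, mul_add, Finset.sum_add_distrib, add_div]

theorem binomMean_one (N : ℕ) : binomMean N (fun _ => 1) = 1 := by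
  have : (∑ j ∈ Finset.range (N + 1), (N.choose j : ℝ)) = 2 ^ N := by
    exact_mod_cast Nat.sum_range_choose N
  simp [binomMean, this]

theorem binomMean_reflect (N : ℕ) (g : ℕ → ℝ) :
    binomMean N (fun j => g (N - j)) = binomMean N g := by
  unfold binomMean
  rw [← Finset.sum_range_reflect (fun j => (N.choose j : ℝ) * g j)]
  congr 1
  refine Finset.sum_congr rfl fun j hj => ?_
  have hj : j ≤ N := by simpa [Nat.lt_succ_iff] using hj
  simp [Nat.choose_symm hj]

theorem binomMean_ite_eq {N k : ℕ} (hk : k ≤ N) :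
    binomMean N (fun j => if j = k then 1 else 0) = N.choose k / 2 ^ N := by
  simp [binomMean, hk]

/-- The probability that a binomial variable is at most `(N - 1) / 2`. -/
noncomputable def lowerTail (N : ℕ) : ℝ := binomMean N fun j => if 2 * j + 1 ≤ N then 1 else 0

/-- The probability that a binomial variable is at most `(N + 1) / 2`. -/
noncomputable def upperTail (N : ℕ) : ℝ := binomMean N fun j => if 2 * j ≤ N + 1 then 1 else 0

/-- The probability that a binomial variable equals the integer part of `(N + 1) / 2`. -/
noncomputable def centralMass (N : ℕ) : ℝ := (N.choose ((N + 1) / 2) : ℝ) / 2 ^ N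

/-- The two events differ only when 2j is N or N + 1, and parity leaves the single value j = ⌊(N +
1)/2⌋. -/
theorem upperTail_eq (N : ℕ) (hN : 1 ≤ N) : upperTail N = lowerTail N + centralMass N := by
  rw [upperTail, lowerTail, centralMass, ← binomMean_ite_eq (by omega), ← binomMean_add]
  congr 1
  ext j
  split_ifs <;> first | omega | norm_num

theorem lowerTail_eq_reflect (N : ℕ) :
    lowerTail N = binomMean N fun j => if N + 1 ≤ 2 * j ∧ j ≤ N then 1 else 0 := by
  rw [lowerTail, ← binomMean_reflect]
  apply le_antisymm <;>
  · refine binomMean_mono fun j hj => ?_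
    split_ifs <;> first | omega | norm_num

theorem lowerTail_le (N : ℕ) : lowerTail N ≤ 1 / 2 := by
  have : lowerTail N + lowerTail N ≤ 1 := by
    nth_rewrite 2 [lowerTail_eq_reflect]
    rw [lowerTail, ← binomMean_add]
    refine (binomMean_mono fun j hj => ?_).trans_eq (binomMean_one N)
    split_ifs <;> first | omega | norm_num
  linarith

theorem one_le_lowerTail_add_upperTail (N : ℕ) : 1 ≤ lowerTail N + upperTail N := by
  rw [lowerTail_eq_reflect, upperTail, ← binomMean_add]
  refine (binomMean_one N).symm.trans_le (binomMean_mono fun j hj => ?_)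
  split_ifs <;> first | omega | norm_num

theorem centralBinom_sq_mul (j : ℕ) :
    ((j.centralBinom : ℝ) / 4 ^ j) ^ 2 * (2 * j + 1) = (Real.Wallis.W j)⁻¹ := by
  rw [Real.Wallis.W_eq_factorial_ratio]
  have h : (j.centralBinom : ℝ) * ((j.factorial : ℝ) * j.factorial) = (2 * j).factorial := by
    have := Nat.choose_mul_factorial_mul_factorial (show j ≤ 2 * j by omega)
    rw [show 2 * j - j = j by omega, mul_assoc] at this
    exact_mod_cast this
  rw [← h]
  have h0 : (j.factorial : ℝ) ≠ 0 := by positivity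
  have h1 : (j.centralBinom : ℝ) ≠ 0 := by exact_mod_cast Nat.centralBinom_ne_zero j
  have h2 : (2 : ℝ) * j + 1 ≠ 0 := by positivity
  rw [show (4 : ℝ) = 2 ^ 2 by norm_num, ← pow_mul, pow_mul 2 4 j]
  rw [show ((2 : ℝ) ^ 4) ^ j = (2 ^ (2 * j)) ^ 2 by rw [← pow_mul, ← pow_mul]; ring_nf]
  field_simp

/-- For odd N = 2m + 1 the coefficient is half of the central one in row 2m + 2, so both parities
reduce to central binomial coefficients and Wallis' product. -/
theorem centralMass_eq (N : ℕ) :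
    centralMass N = (((N + 1) / 2).centralBinom : ℝ) / 4 ^ ((N + 1) / 2) := by
  obtain ⟨m, rfl | rfl⟩ := Nat.even_or_odd' N
  · have : (2 * m + 1) / 2 = m := by omega
    rw [centralMass, this, Nat.centralBinom, pow_mul]
    norm_num
  · have : (2 * m + 1 + 1) / 2 = m + 1 := by omega
    have h : ((m + 1).centralBinom : ℝ) = 2 * (2 * m + 1).choose (m + 1) := by
      have h1 := Nat.choose_succ_succ (2 * m + 1) m
      have h2 := Nat.choose_symm_half m
      rw [Nat.centralBinom, show 2 * (m + 1) = (2 * m + 1).succ by omega,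
        show m + 1 = m.succ from rfl, h1]
      push_cast
      rw [← h2]
      ring
    rw [centralMass, this, h, show (4 : ℝ) = 2 ^ 2 by norm_num, ← pow_mul,
      show 2 * (m + 1) = 2 * m + 1 + 1 by ring, pow_succ _ (2 * m + 1)]
    field_simp

theorem tendsto_centralMass_sq :
    Tendsto (fun N : ℕ => (N : ℝ) * centralMass N ^ 2) atTop (𝓝 (2 / Real.pi)) := by
  have hdiv : Tendsto (fun N : ℕ => (N + 1) / 2) atTop atTop :=
    tendsto_atTop_atTop.2 fun b => ⟨2 * b, fun a ha => by omega⟩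
  have h1 : Tendsto (fun N : ℕ => (Real.Wallis.W ((N + 1) / 2))⁻¹) atTop (𝓝 (2 / Real.pi)) := by
    have := (Real.Wallis.tendsto_W_nhds_pi_div_two.inv₀ (by positivity)).comp hdiv
    rwa [inv_div] at this
  have h2 : Tendsto (fun N : ℕ => (N : ℝ) / (2 * ((N + 1) / 2 : ℕ) + 1)) atTop (𝓝 1) := by
    refine tendsto_of_tendsto_of_tendsto_of_le_of_le
      (tendsto_natCast_div_add_atTop (2 : ℝ)) tendsto_const_nhds ?_ ?_
    · intro N
      have : ((2 * ((N + 1) / 2) + 1 : ℕ) : ℝ) ≤ (N + 2 : ℕ) := by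
        exact_mod_cast (by omega)
      push_cast at this
      dsimp only
      gcongr
    · intro N
      have : ((N : ℕ) : ℝ) ≤ (2 * ((N + 1) / 2) + 1 : ℕ) := by
        exact_mod_cast (by omega)
      dsimp only
      rw [div_le_one (by positivity)]
      exact_mod_cast this
  have h3 := h2.mul h1
  rw [one_mul] at h3
  refine h3.congr fun N => ?_
  rw [← centralBinom_sq_mul, centralMass_eq]
  have : (2 : ℝ) * ((N + 1) / 2 : ℕ) + 1 ≠ 0 := by positivity
  field_simp

theorem tendsto_centralMass : Tendsto centralMass atTop (𝓝 0) := by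
  have h := tendsto_centralMass_sq.mul (tendsto_inv_atTop_nhds_zero_nat (𝕜 := ℝ))
  rw [mul_zero] at h
  have h2 : Tendsto (fun N => centralMass N ^ 2) atTop (𝓝 0) := by
    refine h.congr' ?_
    filter_upwards [eventually_gt_atTop 0] with N hN
    have : (N : ℝ) ≠ 0 := by positivity
    field_simp
  have h3 := h2.sqrt
  rw [Real.sqrt_zero] at h3
  refine h3.congr fun N => Real.sqrt_sq ?_
  unfold centralMass
  positivity

/-- Reflection j ↦ N - j gives L ≤ 1/2 and L + U ≥ 1, which squeezes the mean between 1/2 and 1/2 +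
c/2. -/
theorem tendsto_tail_mean : Tendsto (fun N => (lowerTail N + upperTail N) / 2) atTop (𝓝 (1 / 2)) := by
  have h : Tendsto (fun N => 1 / 2 + centralMass N / 2) atTop (𝓝 (1 / 2)) := by
    have := (tendsto_centralMass.div_const 2).const_add (1 / 2)
    rwa [zero_div, add_zero] at this
  refine tendsto_of_tendsto_of_tendsto_of_le_of_le' tendsto_const_nhds h ?_ ?_
  · exact Eventually.of_forall fun N => by linarith [one_le_lowerTail_add_upperTail N]
  · filter_upwards [eventually_ge_atTop 1] with N hN
    linarith [lowerTail_le N, upperTail_eq N hN]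

end Binomial

/-! ### Mean and variance of the degree count -/

section Degrees

theorem ncard_eq_add_card_filter [Fintype V] {a b : V} (hab : a ≠ b) (s : Set V)
    [DecidablePred (· ∈ s)] [Fintype (Rest a b)] :
    s.ncard = (if a ∈ s then 1 else 0) + (if b ∈ s then 1 else 0)
      + (Finset.univ.filter fun x : Rest a b => x.1 ∈ s).card := by
  classical
  have h : (Finset.univ : Finset V) =
      insert a (insert b (Finset.univ.map (Function.Embedding.subtype fun x => x ≠ a ∧ x ≠ b))) := by
    ext x
    simp
    tauto
  have h1 : s.ncard = ∑ x : V, if x ∈ s then 1 else 0 := by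
    rw [Set.ncard_eq_toFinset_card', Finset.sum_boole, Set.toFinset_card, Fintype.card_subtype]
    rfl
  rw [h1, h, Finset.sum_insert (by simp [hab]), Finset.sum_insert (by simp), Finset.sum_map,
    Finset.card_filter, add_assoc]
  rfl

theorem card_eq_card_rest_add_two [Fintype V] {a b : V} (hab : a ≠ b) [Fintype (Rest a b)] :
    Fintype.card V = Fintype.card (Rest a b) + 2 := by
  classical
  have h := ncard_eq_add_card_filter hab Set.univ
  simp only [Set.ncard_univ, Nat.card_eq_fintype_card, Set.mem_univ, if_true, Finset.filter_true,
    Finset.card_univ] at h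
  omega

/-- The out-degree of `v`. -/
noncomputable def Tournament.outDegree (T : Tournament V) (v : V) : ℕ := {w | T.1.Adj v w}.ncard

open Classical in
/-- The indicator that at most half of the other vertices are out-neighbours of `v`. -/
noncomputable def Tournament.halfIndicator [Fintype V] (v : V) (T : Tournament V) : ℝ :=
  if 2 * T.outDegree v + 1 ≤ Fintype.card V then 1 else 0

open Classical in
theorem Tournament.halfIndicator_left [Fintype V] {a b : V} (hab : a ≠ b) (T : Tournament V) :
    T.halfIndicator a =
      if (T.profile a b).1 then
        (if 2 * (T.profile a b).2.1.card + 1 ≤ Fintype.card (Rest a b) then 1 else 0)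
      else (if 2 * (T.profile a b).2.1.card ≤ Fintype.card (Rest a b) + 1 then 1 else 0) := by
  have h := ncard_eq_add_card_filter hab {w | T.1.Adj a w}
  simp only [Set.mem_ofPred_eq, T.not_adj_self, if_false, zero_add] at h
  simp only [halfIndicator, outDegree, h, profile, card_eq_card_rest_add_two hab]
  by_cases hh : T.1.Adj a b <;> simp only [hh, decide_true,
      decide_false, if_true, if_false, Bool.false_eq_true]
  all_goals
    refine if_congr ?_ rfl rfl
    omega

open Classical in
theorem Tournament.halfIndicator_right [Fintype V] {a b : V} (hab : a ≠ b) (T : Tournament V) :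
    T.halfIndicator b =
      if (T.profile a b).1 then
        (if 2 * (T.profile a b).2.2.card ≤ Fintype.card (Rest a b) + 1 then 1 else 0)
      else (if 2 * (T.profile a b).2.2.card + 1 ≤ Fintype.card (Rest a b) then 1 else 0) := by
  have h := ncard_eq_add_card_filter hab {w | T.1.Adj b w}
  simp only [Set.mem_ofPred_eq, T.not_adj_self, if_false, add_zero, T.adj_comm_iff hab] at h
  simp only [halfIndicator, outDegree, h, profile, card_eq_card_rest_add_two hab]
  by_cases hh : T.1.Adj a b <;> simp only [hh, not_true, not_false_eq_true, decide_true,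
      decide_false, if_true, if_false, Bool.false_eq_true]
  all_goals
    refine if_congr ?_ rfl rfl
    omega

theorem expect_lower {α : Type*} [Fintype α] :
    (𝔼 s : Finset α, if 2 * s.card + 1 ≤ Fintype.card α then (1 : ℝ) else 0) =
      lowerTail (Fintype.card α) :=
  expect_card fun j => if 2 * j + 1 ≤ Fintype.card α then (1 : ℝ) else 0

theorem expect_upper {α : Type*} [Fintype α] :
    (𝔼 s : Finset α, if 2 * s.card ≤ Fintype.card α + 1 then (1 : ℝ) else 0) =
      upperTail (Fintype.card α) :=
  expect_card fun j => if 2 * j ≤ Fintype.card α + 1 then (1 : ℝ) else 0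

theorem expect_halfIndicator [Fintype V] [Nonempty (Tournament V)] {N : ℕ}
    (hN : Fintype.card V = N + 2) (a : V) :
    𝔼 T : Tournament V, T.halfIndicator a = (lowerTail N + upperTail N) / 2 := by
  classical
  have : Nontrivial V := Fintype.one_lt_card_iff_nontrivial.1 (by omega)
  obtain ⟨b, hba⟩ := exists_ne a
  have hab := hba.symm
  obtain rfl : N = Fintype.card (Rest a b) := by
    have := card_eq_card_rest_add_two hab
    omega
  simp_rw [Tournament.halfIndicator_left hab]
  rw [expect_profile hab fun c => if c.1 then
        (if 2 * c.2.1.card + 1 ≤ Fintype.card (Rest a b) then (1 : ℝ) else 0)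
      else (if 2 * c.2.1.card ≤ Fintype.card (Rest a b) + 1 then 1 else 0)]
  have := expect_bool_prod (α := Rest a b)
    (fun s => if 2 * s.card + 1 ≤ Fintype.card (Rest a b) then (1 : ℝ) else 0)
    (fun s => if 2 * s.card ≤ Fintype.card (Rest a b) + 1 then (1 : ℝ) else 0)
    (fun _ => 1) (fun _ => 1)
  rw [expect_lower, expect_upper, Fintype.expect_const] at this
  simp only [mul_one] at this
  convert this

theorem expect_halfIndicator_mul [Fintype V] [Nonempty (Tournament V)] {N : ℕ}
    (hN : Fintype.card V = N + 2) {a b : V} (hab : a ≠ b) :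
    𝔼 T : Tournament V, T.halfIndicator a * T.halfIndicator b = lowerTail N * upperTail N := by
  classical
  obtain rfl : N = Fintype.card (Rest a b) := by
    have := card_eq_card_rest_add_two hab
    omega
  simp_rw [Tournament.halfIndicator_left hab, Tournament.halfIndicator_right hab]
  rw [expect_profile hab fun c => (if c.1 then
        (if 2 * c.2.1.card + 1 ≤ Fintype.card (Rest a b) then (1 : ℝ) else 0)
      else (if 2 * c.2.1.card ≤ Fintype.card (Rest a b) + 1 then 1 else 0)) *
      (if c.1 then
        (if 2 * c.2.2.card ≤ Fintype.card (Rest a b) + 1 then (1 : ℝ) else 0)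
      else (if 2 * c.2.2.card + 1 ≤ Fintype.card (Rest a b) then 1 else 0))]
  have := expect_bool_prod (α := Rest a b)
    (fun s => if 2 * s.card + 1 ≤ Fintype.card (Rest a b) then (1 : ℝ) else 0)
    (fun s => if 2 * s.card ≤ Fintype.card (Rest a b) + 1 then (1 : ℝ) else 0)
    (fun s => if 2 * s.card ≤ Fintype.card (Rest a b) + 1 then (1 : ℝ) else 0)
    (fun s => if 2 * s.card + 1 ≤ Fintype.card (Rest a b) then (1 : ℝ) else 0)
  -- Either direction of the arc gives one lower and one upper tail, so the two branches agree.
  rw [expect_lower, expect_upper, mul_comm (upperTail _), add_self_div_two] at this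
  rw [← this]
  refine Finset.expect_congr (by congr!) fun c _ => ?_
  cases c.1 <;> simp only [if_true, if_false, Bool.false_eq_true]

/-- The number of vertices at most half of whose possible out-arcs are present. -/
noncomputable def Tournament.halfCount [Fintype V] (T : Tournament V) : ℝ :=
  ∑ v, T.halfIndicator v

theorem Tournament.halfIndicator_mul_self [Fintype V] (T : Tournament V) (v : V) :
    T.halfIndicator v * T.halfIndicator v = T.halfIndicator v := by
  unfold halfIndicator
  split_ifs <;> norm_num

theorem expect_halfCount [Fintype V] [Nonempty (Tournament V)] {N : ℕ}
    (hN : Fintype.card V = N + 2) :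
    𝔼 T : Tournament V, T.halfCount = (N + 2) * ((lowerTail N + upperTail N) / 2) := by
  simp only [Tournament.halfCount, Finset.expect_sum_comm, expect_halfIndicator hN,
    Finset.sum_const, Finset.card_univ, hN, nsmul_eq_mul]
  push_cast
  ring

theorem expect_halfCount_sq [Fintype V] [Nonempty (Tournament V)] {N : ℕ}
    (hN : Fintype.card V = N + 2) :
    𝔼 T : Tournament V, T.halfCount ^ 2 = (N + 2) * ((lowerTail N + upperTail N) / 2)
      + (N + 2) * (N + 1) * (lowerTail N * upperTail N) := by
  classical
  simp only [Tournament.halfCount, sq, Finset.sum_mul_sum, Finset.expect_sum_comm]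
  have h : ∀ a : V, ∑ b, 𝔼 T : Tournament V, T.halfIndicator a * T.halfIndicator b =
      (lowerTail N + upperTail N) / 2 + (N + 1) * (lowerTail N * upperTail N) := by
    intro a
    rw [← Finset.add_sum_erase _ _ (Finset.mem_univ a)]
    simp only [Tournament.halfIndicator_mul_self, expect_halfIndicator hN]
    rw [Finset.sum_congr rfl fun b hb => expect_halfIndicator_mul hN (Finset.ne_of_mem_erase hb).symm]
    rw [Finset.sum_const, Finset.card_erase_of_mem (Finset.mem_univ a), Finset.card_univ, hN,
      nsmul_eq_mul, show N + 2 - 1 = N + 1 by omega]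
    push_cast
    ring
  simp only [h, Finset.sum_const, Finset.card_univ, hN, nsmul_eq_mul]
  push_cast
  ring

/-- The variance of `halfCount`. -/
theorem expect_halfCount_sq_sub [Fintype V] [Nonempty (Tournament V)] {N : ℕ}
    (hN : Fintype.card V = N + 2) (hN1 : 1 ≤ N) :
    𝔼 T : Tournament V, T.halfCount ^ 2 - (𝔼 T : Tournament V, T.halfCount) ^ 2 =
      (N + 2) * (((lowerTail N + upperTail N) / 2) * (1 - (lowerTail N + upperTail N) / 2))
      - (N + 2) * (N + 1) * (centralMass N ^ 2 / 4) := by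
  -- The covariance appears through LU - ((L + U)/2)² = -(U - L)²/4.
  rw [expect_halfCount_sq hN, expect_halfCount hN, upperTail_eq N hN1]
  ring

end Degrees

/-! ### Paths of length two and the reduction to degrees -/

section TwoPaths

theorem sum_sum_subset (α : Type*) [Fintype α] [DecidableEq α] :
    ∑ s : Finset α, ∑ t : Finset α, (if s ⊆ t then (1 : ℝ) else 0) = 3 ^ Fintype.card α := by
  rw [Finset.sum_comm]
  have h : ∀ t : Finset α, ∑ s : Finset α, (if s ⊆ t then (1 : ℝ) else 0) =
      2 ^ t.card * 1 ^ (Fintype.card α - t.card) := by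
    intro t
    rw [Finset.sum_boole, one_pow, mul_one]
    have : (Finset.univ.filter fun s : Finset α => s ⊆ t) = t.powerset := by
      ext s
      simp
    rw [this, Finset.card_powerset]
    push_cast
    rfl
  rw [Finset.sum_congr rfl fun t _ => h t, Fintype.sum_pow_mul_eq_add_pow]
  norm_num

-- A missing two-path means that every other out-neighbour of `a` is one of `b`; each remaining
-- vertex allows 3 of its 4 arc patterns.
open Classical in
theorem expect_no_two_path [Fintype V] [Nonempty (Tournament V)] {N : ℕ}
    (hN : Fintype.card V = N + 2) {a b : V} (hab : a ≠ b) :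
    (𝔼 T : Tournament V, if ∀ x, ¬ (T.1.Adj a x ∧ T.1.Adj x b) then (1 : ℝ) else 0)
      = (3 / 4) ^ N := by
  obtain rfl : N = Fintype.card (Rest a b) := by
    have := card_eq_card_rest_add_two hab
    omega
  have h : ∀ T : Tournament V, (∀ x, ¬ (T.1.Adj a x ∧ T.1.Adj x b)) ↔
      (T.profile a b).2.1 ⊆ (T.profile a b).2.2 := by
    intro T
    simp only [Tournament.profile, Finset.subset_iff, Finset.mem_filter, Finset.mem_univ, true_and]
    constructor
    · intro h x hx
      by_contra hb
      exact h x ⟨hx, (T.adj_comm_iff x.2.2.symm).2 hb⟩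
    · rintro h x ⟨h1, h2⟩
      have hxa : x ≠ a := fun h => T.not_adj_self a (h ▸ h1)
      have hxb : x ≠ b := fun h => T.not_adj_self b (h ▸ h2)
      exact T.2.2 x b ⟨h2, h (x := ⟨x, hxa, hxb⟩) h1⟩
  simp_rw [h]
  rw [expect_profile hab fun c => if c.2.1 ⊆ c.2.2 then (1 : ℝ) else 0,
    ← Finset.univ_product_univ, Finset.expect_product]
  refine (Finset.expect_const Finset.univ_nonempty _).trans ?_
  rw [← Finset.univ_product_univ, Finset.expect_product]
  simp only [Fintype.expect_eq_sum_div_card]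
  rw [← Finset.sum_div, sum_sum_subset, Fintype.card_finset, div_div, div_pow]
  push_cast
  rw [← mul_pow]
  norm_num

theorem hasWalk_one_iff (D : Digraph V) (u w : V) : HasWalk D 1 u w ↔ D.Adj u w := by
  simp [HasWalk]

theorem hasWalk_two_iff (D : Digraph V) (u w : V) :
    HasWalk D 2 u w ↔ ∃ x, D.Adj u x ∧ D.Adj x w := by
  simp [HasWalk]

theorem Tournament.nbhd_one (T : Tournament V) (u : V) : nbhd T.1 1 u = {w | T.1.Adj u w} := by
  ext w
  simp only [nbhd, Set.mem_ofPred_eq, hasWalk_one_iff, Nat.lt_one_iff, forall_eq]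
  exact ⟨fun h => h.1, fun h => ⟨h, fun e => T.not_adj_self u (by rwa [← e] at h)⟩⟩

theorem Tournament.nbhd_two (T : Tournament V) (u : V)
    (h : ∀ w, u ≠ w → ∃ x, T.1.Adj u x ∧ T.1.Adj x w) :
    nbhd T.1 2 u = (insert u {w | T.1.Adj u w})ᶜ := by
  ext w
  simp only [nbhd, Set.mem_ofPred_eq, hasWalk_two_iff, Set.mem_compl_iff, Set.mem_insert_iff, not_or]
  constructor
  · rintro ⟨-, h2⟩
    exact ⟨fun e => h2 0 (by norm_num) e.symm,
      fun e => h2 1 (by norm_num) ((hasWalk_one_iff _ _ _).2 e)⟩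
  · rintro ⟨h1, h2⟩
    refine ⟨h w (Ne.symm h1), fun j hj => ?_⟩
    interval_cases j
    · exact fun e => h1 (Eq.symm e)
    · rwa [hasWalk_one_iff]

/-- All vertices other than `u` and its out-neighbours lie at distance two, so |N_2| = n - 1 - d. -/
theorem Tournament.isSeymourVertex_iff [Fintype V] (T : Tournament V) (u : V)
    (h : ∀ w, u ≠ w → ∃ x, T.1.Adj u x ∧ T.1.Adj x w) :
    IsSeymourVertex T.1 u ↔ 2 * T.outDegree u + 1 ≤ Fintype.card V := by
  rw [IsSeymourVertex, T.nbhd_one, T.nbhd_two u h, outDegree]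
  have h1 := Set.ncard_add_ncard_compl (insert u {w | T.1.Adj u w})
  rw [Set.ncard_insert_of_notMem (by simpa using T.not_adj_self u), Nat.card_eq_fintype_card] at h1
  omega

/-- Some ordered pair of distinct vertices is not joined by a path of length two. -/
def Tournament.HasGap (T : Tournament V) : Prop :=
  ∃ a b, a ≠ b ∧ ∀ x, ¬ (T.1.Adj a x ∧ T.1.Adj x b)

theorem Tournament.ncard_seymourSet [Fintype V] (T : Tournament V) (h : ¬ T.HasGap) :
    ((seymourSet T.1).ncard : ℝ) = T.halfCount := by
  classical
  simp only [HasGap, not_exists, not_and, not_forall, not_not] at h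
  have : ∀ v, v ∈ seymourSet T.1 ↔ 2 * T.outDegree v + 1 ≤ Fintype.card V := fun v =>
    T.isSeymourVertex_iff v fun w hw => by
      obtain ⟨x, h1, h2⟩ := h v w hw
      exact ⟨x, h1, h2⟩
  simp only [halfCount, halfIndicator, Finset.sum_boole]
  rw [← Set.ncard_coe_finset]
  congr 2
  ext v
  simp [this]

theorem Tournament.halfCount_nonneg [Fintype V] (T : Tournament V) : 0 ≤ T.halfCount :=
  Finset.sum_nonneg fun v _ => by unfold halfIndicator; split_ifs <;> norm_num

theorem Tournament.halfCount_le [Fintype V] (T : Tournament V) : T.halfCount ≤ Fintype.card V := by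
  have : T.halfCount ≤ ∑ _v : V, (1 : ℝ) :=
    Finset.sum_le_sum fun v _ => by unfold halfIndicator; split_ifs <;> norm_num
  simpa using this

theorem Tournament.ncard_seymourSet_le [Fintype V] (T : Tournament V) :
    ((seymourSet T.1).ncard : ℝ) ≤ Fintype.card V := by
  have := Set.ncard_le_ncard (Set.subset_univ (seymourSet T.1))
  rw [Set.ncard_univ, Nat.card_eq_fintype_card] at this
  exact_mod_cast this

open Classical in
theorem expect_hasGap_le [Fintype V] [Nonempty (Tournament V)] {N : ℕ}
    (hN : Fintype.card V = N + 2) :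
    (𝔼 T : Tournament V, if T.HasGap then (1 : ℝ) else 0) ≤ (N + 2) ^ 2 * (3 / 4) ^ N := by
  calc (𝔼 T : Tournament V, if T.HasGap then (1 : ℝ) else 0)
      ≤ 𝔼 T : Tournament V, ∑ a : V, ∑ b : V,
          if a ≠ b then (if ∀ x, ¬ (T.1.Adj a x ∧ T.1.Adj x b) then (1 : ℝ) else 0) else 0 := by
        refine Finset.expect_le_expect fun T _ => ?_
        have hnn : ∀ a b : V, 0 ≤ if a ≠ b then
            (if ∀ x, ¬ (T.1.Adj a x ∧ T.1.Adj x b) then (1 : ℝ) else 0) else 0 := by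
          intro a b
          split_ifs <;> norm_num
        split_ifs with h
        · obtain ⟨a, b, hab, h⟩ := h
          refine le_trans ?_ (Finset.single_le_sum
            (fun a _ => Finset.sum_nonneg fun b _ => hnn a b) (Finset.mem_univ a))
          refine le_trans ?_ (Finset.single_le_sum (fun b _ => hnn a b) (Finset.mem_univ b))
          rw [if_pos hab, if_pos h]
        · exact Finset.sum_nonneg fun a _ => Finset.sum_nonneg fun b _ => hnn a b
    _ = ∑ a : V, ∑ b : V, 𝔼 T : Tournament V,
          if a ≠ b then (if ∀ x, ¬ (T.1.Adj a x ∧ T.1.Adj x b) then (1 : ℝ) else 0) else 0 := by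
        simp only [Finset.expect_sum_comm]
    _ ≤ ∑ a : V, ∑ b : V, (3 / 4) ^ N := by
        refine Finset.sum_le_sum fun a _ => Finset.sum_le_sum fun b _ => ?_
        by_cases hab : a = b
        · simp only [hab, ne_eq, not_true, if_false, Finset.expect_const_zero]
          positivity
        · simp only [ne_eq, hab, not_false_eq_true, if_true]
          exact (expect_no_two_path hN hab).le
    _ = (N + 2) ^ 2 * (3 / 4) ^ N := by
        simp only [Finset.sum_const, Finset.card_univ, hN, nsmul_eq_mul]
        push_cast
        ring

theorem abs_expect_le {Ω : Type*} [Fintype Ω] (f g : Ω → ℝ) (h : ∀ ω, |f ω| ≤ g ω) :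
    |𝔼 ω, f ω| ≤ 𝔼 ω, g ω :=
  (Finset.abs_expect_le _ _).trans (Finset.expect_le_expect fun ω _ => h ω)

/-- The variance of `|S|` differs from that of `halfCount` by an exponentially small amount. -/
theorem abs_variance_sub_le [Fintype V] [Nonempty (Tournament V)] {N : ℕ}
    (hN : Fintype.card V = N + 2) :
    |(𝔼 T : Tournament V, ((seymourSet T.1).ncard : ℝ) ^ 2
        - (𝔼 T : Tournament V, ((seymourSet T.1).ncard : ℝ)) ^ 2)
      - (𝔼 T : Tournament V, T.halfCount ^ 2 - (𝔼 T : Tournament V, T.halfCount) ^ 2)|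
      ≤ 3 * (N + 2) ^ 4 * (3 / 4) ^ N := by
  classical
  set n : ℝ := N + 2 with hn
  have hcard : (Fintype.card V : ℝ) = n := by rw [hN, hn]; push_cast; rfl
  set ε := 𝔼 T : Tournament V, if T.HasGap then (1 : ℝ) else 0 with hε
  have hε0 : ε ≤ n ^ 2 * (3 / 4) ^ N := expect_hasGap_le hN
  have hn0 : 0 ≤ n := by positivity
  have hS0 : ∀ T : Tournament V, (0 : ℝ) ≤ (seymourSet T.1).ncard := fun T => by positivity
  have hS1 : ∀ T : Tournament V, ((seymourSet T.1).ncard : ℝ) ≤ n := fun T =>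
    hcard ▸ T.ncard_seymourSet_le
  have hY1 : ∀ T : Tournament V, T.halfCount ≤ n := fun T => hcard ▸ T.halfCount_le
  have hd1 : |𝔼 T : Tournament V, (((seymourSet T.1).ncard : ℝ) - T.halfCount)| ≤ n * ε := by
    rw [hε, Finset.mul_expect]
    refine abs_expect_le _ _ fun T => ?_
    split_ifs with h
    · rw [abs_le]
      constructor <;> linarith [hS0 T, hS1 T, hY1 T, T.halfCount_nonneg]
    · rw [T.ncard_seymourSet h, sub_self, abs_zero, mul_zero]
  have hd2 : |𝔼 T : Tournament V, (((seymourSet T.1).ncard : ℝ) ^ 2 - T.halfCount ^ 2)|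
      ≤ n ^ 2 * ε := by
    rw [hε, Finset.mul_expect]
    refine abs_expect_le _ _ fun T => ?_
    split_ifs with h
    · have h1 := pow_le_pow_left₀ (hS0 T) (hS1 T) 2
      have h2 := pow_le_pow_left₀ T.halfCount_nonneg (hY1 T) 2
      rw [abs_le]
      constructor <;> linarith [sq_nonneg ((seymourSet T.1).ncard : ℝ), sq_nonneg T.halfCount]
    · rw [T.ncard_seymourSet h, sub_self, abs_zero, mul_zero]
  rw [Finset.expect_sub_distrib] at hd1 hd2
  have hES : |𝔼 T : Tournament V, ((seymourSet T.1).ncard : ℝ)| ≤ n := by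
    refine (abs_expect_le _ (fun _ => n) fun T => ?_).trans_eq (Fintype.expect_const _)
    rw [abs_of_nonneg (hS0 T)]
    exact hS1 T
  have hEY : |𝔼 T : Tournament V, T.halfCount| ≤ n := by
    refine (abs_expect_le _ (fun _ => n) fun T => ?_).trans_eq (Fintype.expect_const _)
    rw [abs_of_nonneg T.halfCount_nonneg]
    exact hY1 T
  generalize (𝔼 T : Tournament V, ((seymourSet T.1).ncard : ℝ)) = s at *
  generalize (𝔼 T : Tournament V, ((seymourSet T.1).ncard : ℝ) ^ 2) = s2 at *
  generalize (𝔼 T : Tournament V, T.halfCount) = y at *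
  generalize (𝔼 T : Tournament V, T.halfCount ^ 2) = y2 at *
  -- The squared means differ by (s - y)(s + y), where the second factor is at most 2n.
  have h3 : |(s - y) * (s + y)| ≤ n * ε * (2 * n) := by
    rw [abs_mul]
    have : |s + y| ≤ 2 * n := (abs_add_le _ _).trans (by linarith)
    exact mul_le_mul hd1 this (abs_nonneg _) ((abs_nonneg _).trans hd1)
  calc |s2 - s ^ 2 - (y2 - y ^ 2)| = |(s2 - y2) - (s - y) * (s + y)| := by ring_nf
    _ ≤ |s2 - y2| + |(s - y) * (s + y)| := abs_sub _ _
    _ ≤ n ^ 2 * ε + n * ε * (2 * n) := add_le_add hd2 h3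
    _ = 3 * n ^ 2 * ε := by ring
    _ ≤ 3 * n ^ 2 * (n ^ 2 * (3 / 4) ^ N) := by gcongr
    _ = 3 * n ^ 4 * (3 / 4) ^ N := by ring

end TwoPaths

/-! ### Passage to the limit -/

section Asymptotics

theorem integral_randomTournament (n : ℕ) (f : Tournament (Fin n) → ℝ) :
    ∫ T, f T ∂(randomTournament n) = 𝔼 T, f T := by
  have : MeasurableSingletonClass (Tournament (Fin n)) := ⟨fun _ => trivial⟩
  rw [integral_fintype (Integrable.of_finite), Fintype.expect_eq_sum_div_card, Finset.sum_div]
  refine Finset.sum_congr rfl fun T _ => ?_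
  rw [randomTournament, measureReal_def, uniformOn_univ, Measure.count_singleton]
  simp
  ring

theorem varSeymour_eq (n : ℕ) :
    varSeymour n = 𝔼 T : Tournament (Fin n), ((seymourSet T.1).ncard : ℝ) ^ 2
        - (𝔼 T : Tournament (Fin n), ((seymourSet T.1).ncard : ℝ)) ^ 2 := by
  have : DiscreteMeasurableSpace (Tournament (Fin n)) := ⟨fun _ => trivial⟩
  rw [varSeymour, variance_eq_sub MemLp.of_discrete, integral_randomTournament,
    integral_randomTournament]
  rfl

theorem tendsto_varSeymour_div :
    Tendsto (fun n : ℕ => varSeymour n / n) atTop (𝓝 (1 / 4 - 1 / (2 * Real.pi))) := by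
  rw [← tendsto_add_atTop_iff_nat 2]
  have hmain : Tendsto (fun N : ℕ =>
      (lowerTail N + upperTail N) / 2 * (1 - (lowerTail N + upperTail N) / 2)
        - (N * centralMass N ^ 2 + centralMass N ^ 2) / 4) atTop
      (𝓝 (1 / 4 - 1 / (2 * Real.pi))) := by
    have h1 := tendsto_tail_mean.mul (tendsto_tail_mean.const_sub 1)
    have h2 := (tendsto_centralMass_sq.add (tendsto_centralMass.pow 2)).div_const 4
    have h3 := h1.sub h2
    convert h3 using 2
    field_simp
    ring
  have herr : Tendsto (fun N : ℕ => 3 * ((N : ℝ) + 2) ^ 4 * (3 / 4) ^ N) atTop (𝓝 0) := by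
    -- The factor (4/3)² compensates for shifting the exponent from N to N + 2.
    have h := ((tendsto_pow_const_mul_const_pow_of_abs_lt_one 4
      (show |(3 / 4 : ℝ)| < 1 by norm_num [abs_of_pos])).comp (tendsto_add_atTop_nat 2)).const_mul
      (3 * (4 / 3) ^ 2)
    rw [mul_zero] at h
    refine h.congr fun N => ?_
    simp only [Function.comp_apply]
    push_cast
    rw [pow_add]
    ring
  have hdiff : Tendsto (fun N : ℕ => varSeymour (N + 2) / ((N + 2 : ℕ) : ℝ) -
      ((lowerTail N + upperTail N) / 2 * (1 - (lowerTail N + upperTail N) / 2)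
        - (N * centralMass N ^ 2 + centralMass N ^ 2) / 4)) atTop (𝓝 0) := by
    refine squeeze_zero_norm' ?_ herr
    filter_upwards [eventually_ge_atTop 1] with N hN
    have h := abs_variance_sub_le (V := Fin (N + 2)) (Fintype.card_fin _)
    rw [← varSeymour_eq, expect_halfCount_sq_sub (Fintype.card_fin _) hN] at h
    have hn : (1 : ℝ) ≤ (N : ℝ) + 2 := by
      have : (0 : ℝ) ≤ N := by positivity
      linarith
    rw [Real.norm_eq_abs]
    push_cast
    refine le_trans (le_of_eq_of_le ?_ (div_le_self (abs_nonneg _) hn)) h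
    rw [← abs_of_pos (show (0 : ℝ) < (N : ℝ) + 2 by linarith), ← abs_div,
      abs_of_pos (show (0 : ℝ) < (N : ℝ) + 2 by linarith)]
    congr 1
    field_simp
  have := hdiff.add hmain
  rw [zero_add] at this
  exact this.congr fun N => by ring

theorem isEquivalent_varSeymour :
    varSeymour ~[atTop] fun n : ℕ => (1 / 4 - 1 / (2 * Real.pi)) * (n : ℝ) := by
  -- A nonzero constant is needed to turn the limit of the quotient by n into an equivalence; it is
  -- positive because π > 2.
  have hpos : 0 < 1 / 4 - 1 / (2 * Real.pi) := by
    rw [sub_pos]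
    exact one_div_lt_one_div_of_lt (by norm_num) (by linarith [Real.pi_gt_three])
  refine (Asymptotics.isEquivalent_iff_tendsto_one ?_).2 ?_
  · filter_upwards [eventually_gt_atTop 0] with n hn
    have : (0 : ℝ) < n := by exact_mod_cast hn
    positivity
  · have := tendsto_varSeymour_div.div_const (1 / 4 - 1 / (2 * Real.pi))
    rw [div_self hpos.ne'] at this
    refine this.congr fun n => ?_
    rw [Pi.div_apply, div_div, mul_comm]

end Asymptotics

end Seymour

/-- Here `f ~[l] g` is asymptotic equivalence along the filter `l`, and `atTop ⊓ 𝓟 {n | Even n}`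
(resp. `Odd n`) is the filter of `n → ∞` through the even (resp. odd) integers. -/
theorem proposition2p2 :
    (Seymour.varSeymour ~[atTop ⊓ 𝓟 {n : ℕ | Even n}]
      fun n : ℕ => (1 / 4 - 1 / (2 * Real.pi)) * (n : ℝ)) ∧
    (Seymour.varSeymour ~[atTop ⊓ 𝓟 {n : ℕ | Odd n}]
      fun n : ℕ => (1 / 4 - 1 / (2 * Real.pi)) * (n : ℝ)) :=
  ⟨Seymour.isEquivalent_varSeymour.mono inf_le_left,
    Seymour.isEquivalent_varSeymour.mono inf_le_left⟩
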